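/- A weighted system $Az=b$ consists of $m$ linear equations over $\mathbb{F}_2$ in $n$ variables, each containing at least one variable and each having a positive integral weight. The excess of an assignment $z\in\mathbb{F}_2^n$ is the total weight of the satisfied equations minus the total weight of the falsified ones. The system is called irreducible if $\operatorname{rank}A=n$ and no two equations have the same left-hand side. An instance of Max Lin AA is a pair consisting of a weighted system and a parameter $k\in\mathbb{N}$, and the question is whether the maximum excess over all assignments is at least $k$. Systems are encoded as strings over a finite alphabet by listing the coefficients explicitly, and the weights and the parameter are written in binary. **Corollary.** Let $0<a<1$ be a constant, and let $p:\mathbb{N}\to\mathbb{R}$ be a fixed function with $p(n)=O(n^a)$. Then Max Lin AA, restricted to irreducible systems with $m<2^{p(n)}$, has a kernel with $O(k^{1/(1-a)})$ variables. That is, there is a polynomial-time algorithm that maps each instance $(x,k)$ of this restricted problem to an instance $(x',k')$ of the same restricted problem such that 1. $(x,k)$ is a yes-instance if and only if $(x',k')$ is a yes-instance; 2. $k'\le f(k)$ and $|x'|\le g(k)$ for some functions $f,g:\mathbb{N}\to\mathbb{N}$, where $|x'|$ is the length of the encoding of the system $x'$; 3. the number of variables of $x'$ is at most $h(k)$ for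 some function $h$ with $h(k)=O(k^{1/(1-a)})$. -/

import Mathlib

open Filter Asymptotics

/-- A weighted system `A z = b` of `m` linear equations in `n` variables over `𝔽₂` with positive
integral weights; every equation contains at least one variable. -/
structure MaxLinSystem where
  /-- number of variables -/
  n : ℕ
  /-- number of equations -/
  m : ℕ
  /-- coefficient matrix -/
  A : Matrix (Fin m) (Fin n) (ZMod 2)
  /-- right-hand sides -/
  b : Fin m → ZMod 2
  /-- weights -/
  w : Fin m → ℕ
  w_pos : ∀ j, 0 < w j
  row_ne_zero : ∀ j, A j ≠ 0

namespace MaxLinSystem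

/-- The excess of an assignment: the total weight of the satisfied equations minus the total weight
of the falsified equations. -/
def excess (S : MaxLinSystem) (z : Fin S.n → ZMod 2) : ℤ :=
  ∑ j, if S.A.mulVec z j = S.b j then (S.w j : ℤ) else -(S.w j : ℤ)

/-- The maximum excess over all assignments. -/
def maxExcess (S : MaxLinSystem) : ℤ :=
  Finset.univ.sup' ⟨0, Finset.mem_univ _⟩ S.excess

/-- Neither reduction rule changes the system: no variable can be deleted because the columns of
`A` are linearly independent (`rank A = n`), and no two equations can be merged because the
left-hand sides are pairwise distinct. -/
def Irreducible (S : MaxLinSystem) : Prop :=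
  S.A.rank = S.n ∧ ∀ i j, S.A i = S.A j → i = j

/-- The finite alphabet of the problem: the bits `some false`, `some true`, and a separator
`none`. -/
abbrev Symbol : Type := Option Bool

/-- The string describing one equation: the `n` coefficients, the right-hand side, a separator,
the weight in binary, a separator. -/
def encodeEquation (S : MaxLinSystem) (j : Fin S.m) : List Symbol :=
  (List.ofFn fun i => some (decide (S.A j i = 1))) ++ [some (decide (S.b j = 1)), none] ++
    (Computability.encodeNat (S.w j)).map some ++ [none]

/-- The string describing a system: the number of variables in unary, a separator, and the
equations one after another. -/
def encode (S : MaxLinSystem) : List Symbol :=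
  List.replicate S.n (some true) ++ [none] ++ (List.finRange S.m).flatMap S.encodeEquation

end MaxLinSystem

namespace MaxLinAA

/-- An instance of Max Lin AA restricted to irreducible systems with `m < 2 ^ p(n)`:
such a system together with the parameter `k`. -/
structure Instance (p : ℕ → ℝ) where
  /-- the system of equations -/
  system : MaxLinSystem
  /-- the parameter -/
  k : ℕ
  irreducible : system.Irreducible
  m_lt : (system.m : ℝ) < (2 : ℝ) ^ p system.n

variable {p : ℕ → ℝ}

/-- The question of Max Lin AA: is the maximum excess at least `k`? -/
def Instance.IsYes (I : Instance p) : Prop :=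
  (I.k : ℤ) ≤ I.system.maxExcess

/-- The string describing an instance: the parameter in binary, a separator, the system. -/
def Instance.encode (I : Instance p) : List MaxLinSystem.Symbol :=
  (Computability.encodeNat I.k).map some ++ [none] ++ I.system.encode

/-- A kernelization: a polynomial-time computable map `(x, k) ↦ (x', k')` from the problem to
itself that preserves the answer, such that `k' ≤ f(k)` and `|x'| ≤ g(k)` for some functions `f`
and `g`. -/
def IsKernelization (κ : Instance p → Instance p) : Prop :=
  Nonempty (Turing.TM2ComputableInPolyTime
    (Instance.encode (p := p)) (Instance.encode (p := p)) κ) ∧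
  (∀ I, I.IsYes ↔ (κ I).IsYes) ∧
  (∃ f : ℕ → ℕ, ∀ I, (κ I).k ≤ f I.k) ∧
  (∃ g : ℕ → ℕ, ∀ I, (κ I).system.encode.length ≤ g I.k)

end MaxLinAA

/-!
Call a set `K` of equations sum-free if no sum of left-hand sides over a subset of `K` is the
left-hand side of an equation, except trivially. Let `χ j z = ±1` tell whether `z` satisfies the
`j`-th equation. When the assignments are averaged with the nonnegative weight
`∏ i ∈ K, (1 + χ i z)`, only the equations of `K` contribute to the excess, so the maximum excess
is at least the total weight of `K`. A single equation is sum-free, and a sum-free set with more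
than `k` elements exists as soon as `(m + 1) ^ k < 2 ^ n`: some vector is then not a sum of at most
`k` rows, and a representation of this vector with the fewest rows is sum-free.

Hence an instance with a weight `≥ k`, or with `(m + 1) ^ k < 2 ^ n`, is a yes-instance and may be
replaced by the empty one. Comparing binary lengths instead of numbers, and `2 ^ (size k)` instead
of `k`, loses only constant factors and turns both tests into counting and halving, which a Turing
machine does in quadratic time. In the remaining instances `n = O(k (p(n) + 1)) = O(k n ^ a)`, that
is, `n = O(k ^ (1 / (1 - a)))`.
-/

open scoped Pointwise

section SumFree

variable {ι V : Type*}

/-- A finite family `(v i)_{i ∈ K}` is sum-free with respect to the whole family `v` if no member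
of `v` is a sum over a subset of `K`, except in the trivial way. Over `𝔽₂`, for nonzero `v j`, this
single condition comprises the linear independence of `(v i)_{i ∈ K}`. -/
def IsSumFree [AddCommMonoid V] (v : ι → V) (K : Finset ι) : Prop :=
  ∀ T ⊆ K, ∀ j, ∑ i ∈ T, v i = v j → T = {j}

theorem isSumFree_empty [AddCommMonoid V] {v : ι → V} (h0 : ∀ j, v j ≠ 0) : IsSumFree v ∅ := by
  intro T hT j h
  rw [Finset.subset_empty.1 hT, Finset.sum_empty] at h
  exact absurd h.symm (h0 j)

theorem isSumFree_singleton [AddCommMonoid V] {v : ι → V} (hinj : Function.Injective v)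
    (h0 : ∀ j, v j ≠ 0) (i : ι) : IsSumFree v {i} := by
  intro T hT j h
  rcases Finset.subset_singleton_iff.1 hT with rfl | rfl
  · exact isSumFree_empty h0 ∅ subset_rfl j h
  · rw [hinj ((Finset.sum_singleton v i).symm.trans h)]

variable [AddCommGroup V] [Module (ZMod 2) V] {v : ι → V}

theorem IsSumFree.eq_empty_of_sum_eq_zero {K T : Finset ι} (hK : IsSumFree v K) (hT : T ⊆ K)
    (h : ∑ i ∈ T, v i = 0) : T = ∅ := by
  classical
  refine T.eq_empty_of_forall_notMem fun i hi => ?_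
  have hsum : ∑ i ∈ T.erase i, v i = v i := by
    rw [← Finset.add_sum_erase T v hi] at h
    rw [eq_neg_of_add_eq_zero_right h, ZModModule.neg_eq_self]
  have hsingleton : T.erase i = {i} := hK _ ((T.erase_subset i).trans hT) i hsum
  exact T.notMem_erase i (hsingleton ▸ Finset.mem_singleton_self i)

theorem sum_symmDiff_of_zmod_two [DecidableEq ι] (v : ι → V) (s t : Finset ι) :
    ∑ i ∈ symmDiff s t, v i = ∑ i ∈ s, v i + ∑ i ∈ t, v i := by
  have hs := Finset.sum_sdiff (f := v) (Finset.inter_subset_left (s₁ := s) (s₂ := t))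
  have ht := Finset.sum_sdiff (f := v) (Finset.inter_subset_right (s₁ := s) (s₂ := t))
  rw [Finset.sdiff_inter_self_left] at hs
  rw [Finset.sdiff_inter_self_right] at ht
  rw [symmDiff_def, Finset.sup_eq_union, Finset.sum_union disjoint_sdiff_sdiff, ← hs, ← ht,
    add_add_add_comm, ZModModule.add_self, add_zero]

theorem isSumFree_of_forall_card_le (hinj : Function.Injective v) (h0 : ∀ j, v j ≠ 0)
    {K : Finset ι} (hK : ∀ T : Finset ι, ∑ i ∈ T, v i = ∑ i ∈ K, v i → K.card ≤ T.card) :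
    IsSumFree v K := by
  classical
  intro T hT j hsum
  -- Replacing `T` by `j` preserves the sum over `K`, so by minimality `T` has at most one element.
  have hle : K.card ≤ (symmDiff (K \ T) {j}).card := by
    refine hK _ ?_
    rw [sum_symmDiff_of_zmod_two, Finset.sum_singleton, ← hsum, Finset.sum_sdiff hT]
  have hlt : (symmDiff (K \ T) {j}).card ≤ (K \ T).card + 1 :=
    (Finset.card_le_card symmDiff_le_sup).trans (Finset.card_union_le _ _)
  have hcard : (K \ T).card + T.card = K.card := Finset.card_sdiff_add_card_eq_card hT
  have : Nonempty ι := ⟨j⟩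
  obtain ⟨i, hi⟩ := Finset.card_le_one_iff_subset_singleton.1 (show T.card ≤ 1 by lia)
  exact isSumFree_singleton hinj h0 i T hi j hsum

theorem exists_sum_eq_of_mem_span {x : V} (hx : x ∈ Submodule.span (ZMod 2) (Set.range v)) :
    ∃ T : Finset ι, ∑ i ∈ T, v i = x := by
  obtain ⟨c, rfl⟩ := Finsupp.mem_span_range_iff_exists_finsupp.1 hx
  refine ⟨c.support, Finset.sum_congr rfl fun i hi => ?_⟩
  have hone : c i = 1 := (by decide : ∀ x : ZMod 2, x ≠ 0 → x = 1) _ (Finsupp.mem_support_iff.1 hi)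
  simp only [hone, one_smul]

theorem exists_forall_sum_ne_of_pow_lt_card {M : Type*} [AddCommMonoid M] [Fintype ι] [Fintype M]
    (v : ι → M) {k : ℕ} (h : (Fintype.card ι + 1) ^ k < Fintype.card M) :
    ∃ x, ∀ T : Finset ι, T.card ≤ k → ∑ i ∈ T, v i ≠ x := by
  classical
  set B : Finset M := insert 0 (Finset.univ.image v)
  have hcard : (k • B).card < Fintype.card M := by
    refine (Finset.card_nsmul_le.trans (Nat.pow_le_pow_left ?_ k)).trans_lt h
    exact (Finset.card_insert_le _ _).trans (Nat.succ_le_succ Finset.card_image_le)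
  obtain ⟨x, hx⟩ : ∃ x, x ∉ k • B := by
    by_contra! hall
    exact hcard.ne (Finset.card_eq_iff_eq_univ _ |>.2 (Finset.eq_univ_iff_forall.2 hall))
  refine ⟨x, fun T hT hsum => hx (hsum ▸ ?_)⟩
  refine Finset.nsmul_subset_nsmul_right (Finset.mem_insert_self _ _) hT ?_
  rw [← Finset.sum_const, ← Finset.mem_coe, Finset.coe_sum]
  refine Set.finsetSum_mem_finsetSum T _ v fun i _ => ?_
  exact Finset.mem_insert_of_mem (Finset.mem_image_of_mem v (Finset.mem_univ i))

theorem exists_isSumFree_lt_card [Fintype ι] [Fintype V] (hinj : Function.Injective v)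
    (h0 : ∀ j, v j ≠ 0) (hspan : Submodule.span (ZMod 2) (Set.range v) = ⊤) {k : ℕ}
    (h : (Fintype.card ι + 1) ^ k < Fintype.card V) :
    ∃ K : Finset ι, k < K.card ∧ IsSumFree v K := by
  obtain ⟨x, hx⟩ := exists_forall_sum_ne_of_pow_lt_card v h
  obtain ⟨K, hK, hmin⟩ := exists_minimalFor_of_wellFoundedLT
    (fun T : Finset ι => ∑ i ∈ T, v i = x) Finset.card
    (exists_sum_eq_of_mem_span (hspan ▸ Submodule.mem_top))
  refine ⟨K, not_le.1 fun hle => hx K hle hK, isSumFree_of_forall_card_le hinj h0 fun T hT => ?_⟩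
  exact le_of_not_gt fun hlt => hlt.not_ge (hmin (hT.trans hK) hlt.le)

end SumFree

section SignCharacter

/-- The nontrivial additive character of `𝔽₂`, with values `±1` in `ℤ`. -/
def signChar : AddChar (ZMod 2) ℤ := AddChar.zmodChar 2 (ζ := -1) (by norm_num)

theorem signChar_add_eq_ite : ∀ x y : ZMod 2, signChar (x + y) = if x = y then 1 else -1 := by
  decide

theorem one_add_signChar_nonneg : ∀ x : ZMod 2, 0 ≤ 1 + signChar x := by
  decide

theorem addChar_sum_eq_prod {ι A M : Type*} [AddCommMonoid A] [CommMonoid M] (ψ : AddChar A M)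
    (s : Finset ι) (f : ι → A) : ψ (∑ i ∈ s, f i) = ∏ i ∈ s, ψ (f i) :=
  map_prod ψ.toMonoidHom (fun i => Multiplicative.ofAdd (f i)) s

theorem sum_signChar_dotProduct_add {n : Type*} [Fintype n] [DecidableEq n] {v : n → ZMod 2}
    (hv : v ≠ 0) (c : ZMod 2) : ∑ z : n → ZMod 2, signChar (v ⬝ᵥ z + c) = 0 := by
  set ψ : AddChar (n → ZMod 2) ℤ := signChar.compAddMonoidHom
    (AddMonoidHom.mk' (v ⬝ᵥ ·) (dotProduct_add v))
  have hψ : ψ ≠ 0 := by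
    obtain ⟨i, hi⟩ := Function.ne_iff.1 hv
    refine AddChar.ne_zero_iff.2 ⟨Pi.single i 1, ?_⟩
    have hne : signChar (v i) ≠ 1 := (by decide : ∀ x : ZMod 2, x ≠ 0 → signChar x ≠ 1) _ hi
    simpa [ψ] using hne
  simp only [AddChar.map_add_eq_mul, ← Finset.sum_mul]
  exact mul_eq_zero_of_left (AddChar.sum_eq_zero_iff_ne_zero.2 hψ) _

end SignCharacter

namespace MaxLinSystem

variable (S : MaxLinSystem) {K : Finset (Fin S.m)} {j : Fin S.m} (z : Fin S.n → ZMod 2)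

/-- The value `1` if the assignment `z` satisfies the `j`-th equation, and `-1` otherwise. -/
def chi (j : Fin S.m) (z : Fin S.n → ZMod 2) : ℤ := signChar (S.A.row j ⬝ᵥ z + S.b j)

theorem excess_eq_sum_w_mul_chi : S.excess z = ∑ j, (S.w j : ℤ) * S.chi j z := by
  refine Finset.sum_congr rfl fun j _ => ?_
  rw [chi, signChar_add_eq_ite, mul_ite, mul_one, mul_neg_one]
  rfl

theorem prod_chi (T : Finset (Fin S.m)) :
    ∏ i ∈ T, S.chi i z = signChar ((∑ i ∈ T, S.A.row i) ⬝ᵥ z + ∑ i ∈ T, S.b i) := by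
  simp only [chi, ← addChar_sum_eq_prod, Finset.sum_add_distrib, sum_dotProduct]

/-- A nonnegative weight on the assignments, supported on those that satisfy all equations in
`K`. -/
def weight (K : Finset (Fin S.m)) (z : Fin S.n → ZMod 2) : ℤ := ∏ i ∈ K, (1 + S.chi i z)

theorem weight_nonneg (K : Finset (Fin S.m)) : 0 ≤ S.weight K z :=
  Finset.prod_nonneg fun _ _ => one_add_signChar_nonneg _

theorem sum_weight (hK : IsSumFree S.A.row K) : ∑ z, S.weight K z = 2 ^ S.n := by
  simp only [weight, Finset.prod_one_add]
  rw [Finset.sum_comm, Finset.sum_eq_single_of_mem ∅ (Finset.empty_mem_powerset K)]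
  · simp [ZMod.card]
  · intro T hT hne
    simp only [prod_chi]
    refine sum_signChar_dotProduct_add (fun h => hne ?_) _
    exact hK.eq_empty_of_sum_eq_zero (Finset.mem_powerset.1 hT) h

theorem sum_chi_prod_mul_chi {T : Finset (Fin S.m)} (hT : ∑ i ∈ T, S.A.row i ≠ S.A.row j) :
    ∑ z, (∏ i ∈ T, S.chi i z) * S.chi j z = 0 := by
  rw [← sum_signChar_dotProduct_add (v := ∑ i ∈ T, S.A.row i + S.A.row j) ?_
    (∑ i ∈ T, S.b i + S.b j)]
  · refine Finset.sum_congr rfl fun z _ => ?_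
    rw [prod_chi, chi, ← AddChar.map_add_eq_mul, add_dotProduct, add_add_add_comm]
  · rwa [ne_eq, add_eq_zero_iff_eq_neg, ZModModule.neg_eq_self]

theorem sum_weight_mul_chi (hK : IsSumFree S.A.row K) (j : Fin S.m) :
    ∑ z, S.weight K z * S.chi j z = if j ∈ K then 2 ^ S.n else 0 := by
  simp only [weight, Finset.prod_one_add, Finset.sum_mul]
  rw [Finset.sum_comm]
  split_ifs with hj
  · rw [Finset.sum_eq_single_of_mem {j} (by simpa using hj)]
    · have hsq (z) : S.chi j z * S.chi j z = 1 :=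
        (by decide : ∀ x, signChar x * signChar x = 1) _
      simp [hsq, ZMod.card]
    · exact fun T hT hne => S.sum_chi_prod_mul_chi (mt (hK T (Finset.mem_powerset.1 hT) j) hne)
  · refine Finset.sum_eq_zero fun T hT => S.sum_chi_prod_mul_chi fun h => hj ?_
    have hTj := hK T (Finset.mem_powerset.1 hT) j h
    exact Finset.mem_powerset.1 hT (hTj ▸ Finset.mem_singleton_self j)

theorem sum_weight_mul_excess (hK : IsSumFree S.A.row K) :
    ∑ z, S.weight K z * S.excess z = 2 ^ S.n * ∑ j ∈ K, (S.w j : ℤ) := by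
  calc ∑ z, S.weight K z * S.excess z
      = ∑ j, (S.w j : ℤ) * ∑ z, S.weight K z * S.chi j z := by
        simp only [excess_eq_sum_w_mul_chi, Finset.mul_sum, mul_left_comm]
        exact Finset.sum_comm
    _ = 2 ^ S.n * ∑ j ∈ K, (S.w j : ℤ) := by
        simp [S.sum_weight_mul_chi hK, Finset.sum_mul, mul_comm (2 ^ S.n : ℤ)]

theorem sum_w_le_maxExcess (hK : IsSumFree S.A.row K) : ∑ j ∈ K, (S.w j : ℤ) ≤ S.maxExcess := by
  refine le_of_mul_le_mul_left (a := 2 ^ S.n) ?_ (by positivity)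
  rw [← S.sum_weight_mul_excess hK, ← S.sum_weight hK, Finset.sum_mul]
  exact Finset.sum_le_sum fun z _ => mul_le_mul_of_nonneg_left
    (Finset.le_sup' S.excess (Finset.mem_univ z)) (S.weight_nonneg z K)

theorem maxExcess_nonneg : 0 ≤ S.maxExcess := by
  simpa using S.sum_w_le_maxExcess (isSumFree_empty S.row_ne_zero)

theorem card_le_maxExcess (hK : IsSumFree S.A.row K) : (K.card : ℤ) ≤ S.maxExcess := by
  refine le_trans ?_ (S.sum_w_le_maxExcess hK)
  have hcard : K.card ≤ ∑ j ∈ K, S.w j := by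
    simpa using Finset.card_nsmul_le_sum K S.w 1 fun j _ => S.w_pos j
  exact_mod_cast hcard

variable {S}

theorem Irreducible.row_injective (hS : S.Irreducible) : Function.Injective S.A.row := hS.2

theorem Irreducible.w_le_maxExcess (hS : S.Irreducible) (j : Fin S.m) :
    (S.w j : ℤ) ≤ S.maxExcess := by
  simpa using S.sum_w_le_maxExcess (isSumFree_singleton hS.row_injective S.row_ne_zero j)

theorem Irreducible.span_range_row (hS : S.Irreducible) :
    Submodule.span (ZMod 2) (Set.range S.A.row) = ⊤ := by
  refine Submodule.eq_top_of_finrank_eq ?_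
  rw [← S.A.rank_eq_finrank_span_row, hS.1, Module.finrank_fin_fun]

theorem Irreducible.le_maxExcess_of_pow_lt (hS : S.Irreducible) {k : ℕ}
    (h : (S.m + 1) ^ k < 2 ^ S.n) : (k : ℤ) ≤ S.maxExcess := by
  obtain ⟨K, hkK, hK⟩ := exists_isSumFree_lt_card hS.row_injective S.row_ne_zero
    hS.span_range_row (k := k) (by simpa [ZMod.card] using h)
  exact (Nat.cast_le.2 hkK.le).trans (S.card_le_maxExcess hK)

theorem Irreducible.m_le_two_pow (hS : S.Irreducible) : S.m ≤ 2 ^ S.n := by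
  simpa [ZMod.card] using Fintype.card_le_of_injective S.A.row hS.row_injective

end MaxLinSystem

namespace MaxLinAA.KernelMachine

open MaxLinSystem (Symbol)

/-- The stacks of the machine: the input (and output), a reversed copy of the part of the input
read so far, three unary counters for the bits of the parameter, the variables and the separators,
and an auxiliary counter. -/
inductive Stack
  | inp | rev | bits | vars | seps | aux
  deriving DecidableEq

instance : Fintype Stack :=
  ⟨{.inp, .rev, .bits, .vars, .seps, .aux}, fun k => by cases k <;> decide⟩

/-- The labels of the machine. There are two halving loops, told apart by a Boolean. -/
inductive Label
  | readParam | readVars | readRow | readWeight | resetWeight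
  | loop (second : Bool) | halve (second : Bool) | back (second : Bool)
  | test | drain | restore | clear
  deriving DecidableEq, Fintype

open Turing.TM2.Stmt Label

/-- Statements of the machine; the internal state is the symbol popped last. -/
abbrev Stmt : Type := Turing.TM2.Stmt (fun _ : Stack => Symbol) Label (Option Symbol)

/-- Configurations of the machine. -/
abbrev Cfg : Type := Turing.TM2.Cfg (fun _ : Stack => Symbol) Label (Option Symbol)

/-- Reset the internal state and jump to a label. -/
def jump (l : Label) : Stmt := load (fun _ => none) (goto fun _ => l)

/-- Pop a symbol into the internal state. -/
def fetch (k : Stack) (q : Stmt) : Stmt := pop k (fun _ x => x) q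

/-- Increment a unary counter. -/
def incr (k : Stack) (q : Stmt) : Stmt := push k (fun _ => none) q

/-- Push the internal state. -/
def save (k : Stack) (q : Stmt) : Stmt := push k (fun x => x.getD none) q

/-- Test whether the symbol popped last is a bit. -/
def ifBit (q₁ q₂ : Stmt) : Stmt := branch (fun x => (x.getD none).isSome) q₁ q₂

/-- Test whether the stack popped last was nonempty. -/
def ifSome (q₁ q₂ : Stmt) : Stmt := branch Option.isSome q₁ q₂

/-- Pop a symbol, remembering whether any stack popped so far was nonempty. -/
def discard (k : Stack) (q : Stmt) : Stmt := pop k (fun x y => x.or y) q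

/-- The stack that counts the passes of a halving loop. -/
def counter : Bool → Stack
  | false => .bits
  | true => .vars

/-- The stack that is halved by a halving loop. -/
def target : Bool → Stack
  | false => .vars
  | true => .seps

/-- The label at which a halving loop is left. -/
def exit : Bool → Label
  | false => loop true
  | true => test

/-- The program. It counts the bits of the parameter, the variables and the separators, and checks
on the way that no weight is longer than the parameter. Then it halves the number of variables once
for each bit of the parameter, and the number of separators once for each unit of the result. The
input is replaced by the empty instance if some weight is too long or no separator is left. -/
def program : Label → Stmt
  | readParam => fetch .inp <| save .rev <|
      ifBit (incr .bits <| jump readParam) (incr .seps <| jump readVars)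
  | readVars => fetch .inp <| save .rev <|
      ifBit (incr .vars <| jump readVars) (incr .seps <| jump readRow)
  | readRow => fetch .inp <| ifSome (save .rev <|
      ifBit (jump readRow) (incr .seps <| jump readWeight)) (jump (loop false))
  | readWeight => fetch .inp <| save .rev <|
      ifBit (fetch .bits <| ifSome (incr .aux <| jump readWeight) (jump clear))
        (incr .seps <| jump resetWeight)
  | resetWeight => fetch .aux <| ifSome (incr .bits <| jump resetWeight) (jump readRow)
  | loop x => fetch (counter x) <| ifSome (jump (halve x)) (jump (exit x))
  | halve x => fetch (target x) <| fetch (target x) <|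
      ifSome (incr .aux <| jump (halve x)) (jump (back x))
  | back x => fetch .aux <| ifSome (incr (target x) <| jump (back x)) (jump (loop x))
  | test => fetch .seps <| ifSome (jump drain) (jump clear)
  | drain => fetch .seps <| ifSome (jump drain) (jump restore)
  | restore => fetch .rev <| ifSome (save .inp <| jump restore) halt
  | clear => discard .inp <| discard .rev <| discard .bits <| discard .vars <| discard .seps <|
      discard .aux <| ifSome (jump clear) (incr .inp <| incr .inp halt)

/-- The contents of the stacks. -/
def contents (I R : List Symbol) (b v s a : ℕ) : Stack → List Symbol
  | .inp => I
  | .rev => R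
  | .bits => List.replicate b none
  | .vars => List.replicate v none
  | .seps => List.replicate s none
  | .aux => List.replicate a none

/-- A configuration between two steps. -/
def cfg (l : Label) (I R : List Symbol) (b v s a : ℕ) : Cfg := ⟨some l, none, contents I R b v s a⟩

/-- A final configuration. -/
def final (O : List Symbol) : Cfg := ⟨none, none, contents O [] 0 0 0 0⟩

/-- A configuration during a halving loop: `c` passes remain and `t` is being halved. -/
def loopCfg : Bool → Label → List Symbol → ℕ → ℕ → ℕ → ℕ → Cfg
  | false, l, R, c, t, o, a => cfg l [] R c t o a
  | true, l, R, c, t, o, a => cfg l [] R o c t a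

/-- The machine reaches `c'` from `c` in at most `t` steps. -/
def Run (t : ℕ) (c c' : Cfg) : Prop :=
  Nonempty (StateTransition.EvalsToInTime (Turing.TM2.step program) c (some c') t)

theorem Run.refl (c : Cfg) : Run 0 c c := ⟨.refl _ _⟩

theorem Run.trans {t t' : ℕ} {c c' c'' : Cfg} (h : Run t c c') (h' : Run t' c' c'') :
    Run (t + t') c c'' := by
  obtain ⟨h⟩ := h
  obtain ⟨h'⟩ := h'
  exact ⟨Nat.add_comm t' t ▸ StateTransition.EvalsToInTime.trans _ _ _ _ _ _ h h'⟩

theorem Run.mono {t t' : ℕ} {c c' : Cfg} (h : Run t c c') (ht : t ≤ t') : Run t' c c' :=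
  h.map fun h => ⟨h.toEvalsTo, h.steps_le_m.trans ht⟩

theorem some_cfg_congr {l : Option Label} {v : Option Symbol} {S S' : Stack → List Symbol}
    (h : ∀ k, S k = S' k) : (some ⟨l, v, S⟩ : Option Cfg) = some ⟨l, v, S'⟩ := by
  rw [funext h]

/-- Prepends a step of the machine; the default argument executes it symbolically. -/
theorem Run.step {t : ℕ} {c c' c'' : Cfg} (h : Run t c' c'')
    (hstep : Turing.TM2.step program c = some c' := by
      exact some_cfg_congr fun k => by cases k <;> rfl) : Run (t + 1) c c'' := by
  have h₁ : Run 1 c c' := ⟨⟨⟨1, hstep⟩, le_rfl⟩⟩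
  exact (h₁.trans h).mono (by lia)

theorem step_clear_of_ne_nil {S : Stack → List Symbol} {k : Stack} (hk : S k ≠ []) :
    Turing.TM2.step program ⟨some clear, none, S⟩ =
      some ⟨some clear, none, fun k => (S k).tail⟩ := by
  have hsome : ((S .inp).head?.isSome || (S .rev).head?.isSome || (S .bits).head?.isSome ||
      (S .vars).head?.isSome || (S .seps).head?.isSome || (S .aux).head?.isSome) = true := by
    cases k <;> simp [hk]
  simp only [Turing.TM2.step, Turing.TM2.stepAux, program, discard, ifSome, jump, Option.none_or,
    Option.isSome_or, ne_eq, reduceCtorEq, not_false_eq_true, Function.update_of_ne, hsome,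
    cond_true]
  exact some_cfg_congr fun k => by cases k <;> rfl

theorem run_clear {t : ℕ} {S : Stack → List Symbol} (hS : ∀ k, (S k).length ≤ t) :
    Run (t + 1) ⟨some clear, none, S⟩ (final [none, none]) := by
  induction t generalizing S with
  | zero =>
    obtain rfl : S = fun _ => [] :=
      funext fun k => List.eq_nil_of_length_eq_zero (Nat.le_zero.1 (hS k))
    exact (Run.refl _).step
  | succ t ih =>
    by_cases hempty : ∀ k, S k = []
    · exact (ih fun k => by simp [hempty k]).mono (Nat.le_succ _)
    · obtain ⟨k, hk⟩ := not_forall.1 hempty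
      refine (ih fun k => ?_).step (step_clear_of_ne_nil hk)
      rw [List.length_tail]
      exact Nat.sub_le_of_le_add (hS k)

section Subroutines

variable (l : List Bool) (I R : List Symbol) (b v s a : ℕ)

theorem run_restore : Run (R.length + 1) (cfg restore I R 0 0 0 0) (final (R.reverseAux I)) := by
  induction R generalizing I with
  | nil => exact (Run.refl _).step
  | cons x R ih => exact (ih (x :: I)).step

theorem run_drain : Run (s + 1) (cfg drain I R b v s a) (cfg restore I R b v 0 a) := by
  induction s with
  | zero => exact (Run.refl _).step
  | succ s ih => exact ih.step

theorem run_readParam :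
    Run (l.length + 1) (cfg readParam (l.map some ++ none :: I) R b v s a)
      (cfg readVars I (none :: (l.map some).reverseAux R) (b + l.length) v (s + 1) a) := by
  induction l generalizing R b with
  | nil => exact (Run.refl _).step
  | cons x l ih =>
    rw [show b + (x :: l).length = b + 1 + l.length from Nat.add_right_comm b l.length 1]
    exact (ih (some x :: R) (b + 1)).step

theorem run_readVars :
    Run (l.length + 1) (cfg readVars (l.map some ++ none :: I) R b v s a)
      (cfg readRow I (none :: (l.map some).reverseAux R) b (v + l.length) (s + 1) a) := by
  induction l generalizing R v with
  | nil => exact (Run.refl _).step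
  | cons x l ih =>
    rw [show v + (x :: l).length = v + 1 + l.length from Nat.add_right_comm v l.length 1]
    exact (ih (some x :: R) (v + 1)).step

theorem run_readRow :
    Run (l.length + 1) (cfg readRow (l.map some ++ none :: I) R b v s a)
      (cfg readWeight I (none :: (l.map some).reverseAux R) b v (s + 1) a) := by
  induction l generalizing R with
  | nil => exact (Run.refl _).step
  | cons x l ih => exact (ih (some x :: R)).step

theorem run_readWeight :
    Run (l.length + 1) (cfg readWeight (l.map some ++ none :: I) R (b + l.length) v s a)
      (cfg resetWeight I (none :: (l.map some).reverseAux R) b v (s + 1) (a + l.length)) := by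
  induction l generalizing R a with
  | nil => exact (Run.refl _).step
  | cons x l ih =>
    rw [show a + (x :: l).length = a + 1 + l.length from Nat.add_right_comm a l.length 1]
    exact (ih (some x :: R) (a + 1)).step

theorem run_resetWeight :
    Run (a + 1) (cfg resetWeight I R b v s a) (cfg readRow I R (b + a) v s 0) := by
  induction a generalizing b with
  | zero => exact (Run.refl _).step
  | succ a ih =>
    rw [show b + (a + 1) = b + 1 + a from Nat.add_right_comm b a 1]
    exact (ih (b + 1)).step

variable {l I R b v s a}

theorem run_readWeight_of_lt {N : ℕ} (h : b < l.length)
    (hN : I.length + R.length + l.length + 1 + b + v + s + a ≤ N) :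
    Run (l.length + N + 2) (cfg readWeight (l.map some ++ none :: I) R b v s a)
      (final [none, none]) := by
  induction l generalizing R b a with
  | nil => simp at h
  | cons x l ih =>
    simp only [List.length_cons] at h hN
    cases b with
    | zero =>
      have hclear : ∀ k, (contents (l.map some ++ none :: I) (some x :: R) 0 v s a k).length ≤ N :=
        fun k => by cases k <;> simp [contents] <;> lia
      exact (Run.step (run_clear hclear)).mono (by lia)
    | succ b =>
      refine (Run.step (ih (R := some x :: R) (a := a + 1) (Nat.lt_of_succ_lt_succ h) ?_)).mono ?_
      · rw [List.length_cons]; lia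
      · rw [List.length_cons]; lia

end Subroutines

section Halving

variable (R : List Symbol) (x : Bool) (c t o a : ℕ)

theorem run_back :
    Run (a + 1) (loopCfg x (back x) R c t o a) (loopCfg x (loop x) R c (t + a) o 0) := by
  induction a generalizing t with
  | zero => cases x <;> exact (Run.refl _).step
  | succ a ih =>
    rw [show t + (a + 1) = t + 1 + a from Nat.add_right_comm t a 1]
    cases x <;> exact (ih (t + 1)).step

theorem run_halve :
    Run (t / 2 + 1) (loopCfg x (halve x) R c t o a)
      (loopCfg x (back x) R c 0 o (a + t / 2)) := by
  induction t using Nat.twoStepInduction generalizing a with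
  | zero | one => cases x <;> exact (Run.refl _).step
  | more t ih _ =>
    rw [show (t + 2) / 2 = t / 2 + 1 by lia, ← Nat.add_assoc a, Nat.add_right_comm a]
    cases x <;> exact (ih (a + 1)).step

theorem run_loop :
    Run (c * (t + 3) + 1) (loopCfg x (loop x) R c t o 0)
      (loopCfg x (exit x) R 0 (t / 2 ^ c) o 0) := by
  induction c generalizing t with
  | zero =>
    rw [pow_zero, Nat.div_one, Nat.zero_mul]
    cases x <;> exact (Run.refl _).step
  | succ c ih =>
    have hpass : Run (t / 2 + 1 + (t / 2 + 1) + 1) (loopCfg x (loop x) R (c + 1) t o 0)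
        (loopCfg x (loop x) R c (t / 2) o 0) := by
      have h := (run_halve R x c t o 0).trans (run_back R x c 0 o (0 + t / 2))
      rw [Nat.zero_add, Nat.zero_add] at h
      cases x <;> exact h.step
    have h := hpass.trans (ih (t / 2))
    rw [Nat.div_div_eq_div_mul, ← pow_succ'] at h
    refine h.mono ?_
    have hle : c * (t / 2 + 3) ≤ c * (t + 3) := Nat.mul_le_mul_left _ (by lia)
    rw [add_mul]
    lia

end Halving

/-- The string that describes an equation, cut into the coefficients together with the right-hand
side, and the binary digits of the weight. -/
structure RawEquation where
  /-- the coefficients and the right-hand side -/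
  coeffs : List Bool
  /-- the binary digits of the weight -/
  weight : List Bool

namespace RawEquation

/-- The string that the machine reads for an equation. -/
def encode (e : RawEquation) : List Symbol :=
  e.coeffs.map some ++ none :: (e.weight.map some ++ [none])

variable (e : RawEquation)

theorem length_encode : e.encode.length = e.coeffs.length + e.weight.length + 2 := by
  simp [encode]
  lia

theorem encode_append (I : List Symbol) :
    e.encode ++ I = e.coeffs.map some ++ none :: (e.weight.map some ++ none :: I) := by
  simp [encode]

theorem reverseAux_encode (R : List Symbol) :
    e.encode.reverseAux R =
      none :: (e.weight.map some).reverseAux (none :: (e.coeffs.map some).reverseAux R) := by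
  simp [encode, List.reverseAux_eq]

end RawEquation

theorem two_mul_length_le_length_flatMap_encode (E : List RawEquation) :
    2 * E.length ≤ (E.flatMap RawEquation.encode).length := by
  have h := List.card_nsmul_le_sum (E.map fun e => e.encode.length) 2 fun x hx => by
    obtain ⟨e, -, rfl⟩ := List.mem_map.1 hx
    rw [e.length_encode]
    lia
  rwa [List.length_map, smul_eq_mul, mul_comm, ← List.length_flatMap] at h

theorem run_equation {e : RawEquation} {b : ℕ} (h : e.weight.length ≤ b) (I R : List Symbol)
    (v s : ℕ) :
    Run (2 * e.encode.length) (cfg readRow (e.encode ++ I) R b v s 0)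
      (cfg readRow I (e.encode.reverseAux R) b v (s + 2) 0) := by
  obtain ⟨b, rfl⟩ := Nat.exists_eq_add_of_le' h
  rw [e.encode_append, e.reverseAux_encode, e.length_encode]
  have hrow := run_readRow e.coeffs (e.weight.map some ++ none :: I) R (b + e.weight.length) v s 0
  have hweight := run_readWeight e.weight I (none :: (e.coeffs.map some).reverseAux R) b v (s + 1) 0
  have hreset := run_resetWeight I
    (none :: (e.weight.map some).reverseAux (none :: (e.coeffs.map some).reverseAux R)) b v (s + 2)
    (0 + e.weight.length)
  rw [Nat.zero_add] at hweight hreset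
  exact ((hrow.trans hweight).trans hreset).mono (by lia)

theorem run_equation_of_lt {e : RawEquation} {b v s N : ℕ} {I R : List Symbol}
    (h : b < e.weight.length)
    (hN : e.encode.length + I.length + R.length + b + v + (s + 2) ≤ N) :
    Run (2 * e.encode.length + N + 2) (cfg readRow (e.encode ++ I) R b v s 0)
      (final [none, none]) := by
  rw [e.length_encode] at hN ⊢
  rw [e.encode_append]
  have hrow := run_readRow e.coeffs (e.weight.map some ++ none :: I) R b v s 0
  refine (hrow.trans (run_readWeight_of_lt (N := N) h ?_)).mono (by lia)
  simp only [List.length_cons, List.reverseAux_eq, List.length_append, List.length_reverse,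
    List.length_map]
  lia

theorem run_equations {E : List RawEquation} {b : ℕ} (h : ∀ e ∈ E, e.weight.length ≤ b)
    (R : List Symbol) (v s : ℕ) :
    Run (2 * (E.flatMap RawEquation.encode).length + 1)
      (cfg readRow (E.flatMap RawEquation.encode) R b v s 0)
      (cfg (loop false) [] ((E.flatMap RawEquation.encode).reverseAux R) b v
        (s + 2 * E.length) 0) := by
  induction E generalizing R s with
  | nil => exact (Run.refl _).step
  | cons e E ih =>
    have hrest := ih (fun _ he => h _ (List.mem_cons_of_mem _ he)) (e.encode.reverseAux R) (s + 2)
    have hrun := (run_equation (h e List.mem_cons_self) (E.flatMap RawEquation.encode) R v s).trans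
      hrest
    rw [List.flatMap_cons, List.length_cons, List.length_append,
      show s + 2 * (E.length + 1) = s + 2 + 2 * E.length by lia]
    simp only [List.reverseAux_eq, List.reverse_append, List.append_assoc] at hrun ⊢
    exact hrun.mono (by lia)

theorem run_equations_of_exists_lt {E : List RawEquation} {b v s N : ℕ} {R : List Symbol}
    (h : ∃ e ∈ E, b < e.weight.length)
    (hN : (E.flatMap RawEquation.encode).length + R.length + b + v + (s + 2 * E.length) ≤ N) :
    Run (2 * (E.flatMap RawEquation.encode).length + N + 2)
      (cfg readRow (E.flatMap RawEquation.encode) R b v s 0) (final [none, none]) := by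
  induction E generalizing R s with
  | nil => simp at h
  | cons e E ih =>
    rw [List.flatMap_cons, List.length_append, List.length_cons] at hN
    rw [List.flatMap_cons, List.length_append]
    rcases lt_or_ge b e.weight.length with he | he
    · exact (run_equation_of_lt (N := N) he (by lia)).mono (by lia)
    · have hE : ∃ e ∈ E, b < e.weight.length := by simpa [he.not_gt] using h
      have hrest := ih (R := e.encode.reverseAux R) (s := s + 2) hE (by
        rw [List.reverseAux_eq, List.length_append, List.length_reverse]
        lia)
      exact ((run_equation he _ R v s).trans hrest).mono (by lia)

/-- The string that describes an instance, cut into the binary digits of the parameter, the unary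
digits of the number of variables, and the equations. -/
structure RawInstance where
  /-- the binary digits of the parameter -/
  param : List Bool
  /-- the unary digits of the number of variables -/
  vars : List Bool
  /-- the equations -/
  equations : List RawEquation

namespace RawInstance

/-- The string that the machine reads for an instance. -/
def encode (X : RawInstance) : List Symbol :=
  X.param.map some ++ none :: (X.vars.map some ++ none :: X.equations.flatMap RawEquation.encode)

/-- The condition under which the machine replaces its input by the empty instance. -/
def IsEvident (X : RawInstance) : Prop :=
  (∃ e ∈ X.equations, X.param.length < e.weight.length) ∨
    2 * X.equations.length + 2 < 2 ^ (X.vars.length / 2 ^ X.param.length)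

/-- The input that has been read, in reverse order, when the machine arrives at the equations. -/
def header (X : RawInstance) : List Symbol :=
  none :: (X.vars.map some).reverseAux (none :: (X.param.map some).reverseAux [])

variable (X : RawInstance)

theorem length_encode : X.encode.length =
    X.param.length + X.vars.length + (X.equations.flatMap RawEquation.encode).length + 2 := by
  simp only [encode, List.length_append, List.length_cons, List.length_map]
  lia

theorem length_header : X.header.length = X.param.length + X.vars.length + 2 := by
  simp [header, List.reverseAux_eq]
  lia

theorem reverseAux_header :
    (X.equations.flatMap RawEquation.encode).reverseAux X.header = X.encode.reverse := by
  simp [header, encode, List.reverseAux_eq]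

end RawInstance

section Program

variable (X : RawInstance)

theorem run_header :
    Run (X.param.length + X.vars.length + 2) (cfg readParam X.encode [] 0 0 0 0)
      (cfg readRow (X.equations.flatMap RawEquation.encode) X.header X.param.length
        X.vars.length 2 0) := by
  have hparam := run_readParam X.param
    (X.vars.map some ++ none :: X.equations.flatMap RawEquation.encode) [] 0 0 0 0
  have hvars := run_readVars X.vars (X.equations.flatMap RawEquation.encode)
    (none :: (X.param.map some).reverseAux []) (0 + X.param.length) 0 1 0
  rw [Nat.zero_add] at hparam hvars
  rw [Nat.zero_add] at hvars
  exact (hparam.trans hvars).mono (by lia)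

theorem run_halvings (R : List Symbol) (b v s : ℕ) :
    Run (b * (v + 3) + v * (s + 3) + 2) (cfg (loop false) [] R b v s 0)
      (cfg test [] R 0 0 (s / 2 ^ (v / 2 ^ b)) 0) := by
  have hvars := run_loop R false b v s
  have hseps := run_loop R true (v / 2 ^ b) s 0
  have hle : v / 2 ^ b * (s + 3) ≤ v * (s + 3) := Nat.mul_le_mul_right _ (Nat.div_le_self _ _)
  exact (hvars.trans hseps).mono (by lia)

theorem run_output (R : List Symbol) (s : ℕ) :
    Run (R.length + s + 2) (cfg test [] R 0 0 s 0)
      (final (if s = 0 then [none, none] else R.reverse)) := by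
  cases s with
  | zero =>
    have hclear : ∀ k, (contents [] R 0 0 0 0 k).length ≤ R.length := fun k => by
      cases k <;> simp [contents]
    exact Run.step (run_clear hclear)
  | succ s =>
    have hrun := (run_drain [] R 0 0 s 0).trans (run_restore [] R)
    exact (Run.step hrun).mono (by lia)

variable {X}

theorem run_program_of_exists_lt (h : ∃ e ∈ X.equations, X.param.length < e.weight.length) :
    Run (4 * (X.encode.length + 3) ^ 2) (cfg readParam X.encode [] 0 0 0 0)
      (final [none, none]) := by
  have hE := two_mul_length_le_length_flatMap_encode X.equations
  have hread := run_equations_of_exists_lt (v := X.vars.length) (s := 2) (R := X.header)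
    (N := 2 * X.encode.length) h (by rw [X.length_header, X.length_encode]; lia)
  refine ((run_header X).trans hread).mono ?_
  rw [X.length_encode]
  nlinarith

theorem run_program_of_forall_le (h : ∀ e ∈ X.equations, e.weight.length ≤ X.param.length) :
    Run (4 * (X.encode.length + 3) ^ 2) (cfg readParam X.encode [] 0 0 0 0)
      (final (if (2 * X.equations.length + 2) / 2 ^ (X.vars.length / 2 ^ X.param.length) = 0
        then [none, none] else X.encode)) := by
  set s := 2 * X.equations.length + 2 with hs
  have hread := (run_header X).trans (run_equations h X.header X.vars.length 2)
  rw [Nat.add_comm 2, X.reverseAux_header] at hread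
  have houtput := run_output X.encode.reverse (s / 2 ^ (X.vars.length / 2 ^ X.param.length))
  rw [List.reverse_reverse, List.length_reverse] at houtput
  refine ((hread.trans (run_halvings _ _ _ _)).trans houtput).mono ?_
  have hE := two_mul_length_le_length_flatMap_encode X.equations
  have hdiv := Nat.div_le_self s (2 ^ (X.vars.length / 2 ^ X.param.length))
  have hlen := X.length_encode
  have hparam : X.param.length * (X.vars.length + 3) ≤ X.param.length * (X.encode.length + 3) :=
    Nat.mul_le_mul_left _ (by lia)
  have hvars : X.vars.length * (s + 3) ≤ X.vars.length * (X.encode.length + 3) :=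
    Nat.mul_le_mul_left _ (by lia)
  nlinarith

theorem run_program (X : RawInstance) [Decidable X.IsEvident] :
    Run (4 * (X.encode.length + 3) ^ 2) (cfg readParam X.encode [] 0 0 0 0)
      (final (if X.IsEvident then [none, none] else X.encode)) := by
  by_cases h : ∃ e ∈ X.equations, X.param.length < e.weight.length
  · rw [if_pos (.inl h)]
    exact run_program_of_exists_lt h
  · convert run_program_of_forall_le (X := X) (by simpa using h) using 3
    rw [RawInstance.IsEvident, or_iff_right h, Nat.div_eq_zero_iff_lt (Nat.two_pow_pos _)]

end Program

/-- The kernelization machine. -/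
def machine : Turing.FinTM2 where
  K := Stack
  k₀ := .inp
  k₁ := .inp
  Γ _ := Symbol
  Λ := Label
  main := .readParam
  σ := Option Symbol
  initialState := none
  Γk₀Fin := inferInstanceAs (Fintype Symbol)
  m := program

theorem initList_machine (s : List Symbol) :
    Turing.initList machine s = cfg .readParam s [] 0 0 0 0 :=
  congrArg (Turing.TM2.Cfg.mk _ _) (funext fun k => by cases k <;> rfl)

theorem haltList_machine (s : List Symbol) : Turing.haltList machine s = final s :=
  congrArg (Turing.TM2.Cfg.mk _ _) (funext fun k => by cases k <;> rfl)

theorem nonempty_tm2ComputableInPolyTime {α β : Type} {ea : α → List Symbol} {eb : β → List Symbol}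
    {f : α → β} (T : Polynomial ℕ)
    (h : ∀ x, Run (T.eval (ea x).length) (cfg .readParam (ea x) [] 0 0 0 0) (final (eb (f x)))) :
    Nonempty (Turing.TM2ComputableInPolyTime ea eb f) := by
  have hid (l : List Symbol) : l.map (Equiv.refl Symbol).invFun = l := List.map_id l
  have hout (x : α) : Nonempty (Turing.TM2OutputsInTime machine
      ((ea x).map (Equiv.refl Symbol).invFun : List Symbol)
      (some ((eb (f x)).map (Equiv.refl Symbol).invFun : List Symbol)) (T.eval (ea x).length)) := by
    have hrun := h x
    rw [← initList_machine, ← haltList_machine] at hrun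
    rw [hid, hid]
    exact hrun
  exact ⟨⟨⟨machine, .refl _, .refl _⟩, T, fun x => (hout x).some⟩⟩

end MaxLinAA.KernelMachine

namespace MaxLinAA

theorem length_encodeNat (n : ℕ) : (Computability.encodeNat n).length = n.size := by
  have hpos (p : PosNum) : (Computability.encodePosNum p).length = p.natSize := by
    induction p with
    | one => rfl
    | bit0 p ih | bit1 p ih => simp [Computability.encodePosNum, PosNum.natSize, ih]
  have hnum (m : Num) : (Computability.encodeNum m).length = m.natSize := by
    cases m with
    | zero => rfl
    | pos p => exact hpos p
  rw [Computability.encodeNat, hnum, Num.natSize_to_nat, Num.to_of_nat]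

end MaxLinAA

namespace MaxLinSystem

theorem length_encodeEquation (S : MaxLinSystem) (j : Fin S.m) :
    (S.encodeEquation j).length = S.n + 3 + (S.w j).size := by
  simp [encodeEquation, MaxLinAA.length_encodeNat]
  lia

theorem length_encode_le (S : MaxLinSystem) {L : ℕ} (h : ∀ j, (S.w j).size ≤ L) :
    S.encode.length ≤ S.n + 1 + S.m * (S.n + 3 + L) := by
  have hsum := List.sum_le_card_nsmul
    ((List.finRange S.m).map fun j => (S.encodeEquation j).length) (S.n + 3 + L) fun x hx => by
      obtain ⟨j, -, rfl⟩ := List.mem_map.1 hx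
      rw [S.length_encodeEquation]
      exact Nat.add_le_add_left (h j) _
  rw [List.length_map, List.length_finRange, smul_eq_mul] at hsum
  simp only [encode, List.length_append, List.length_replicate, List.length_singleton,
    List.length_flatMap]
  lia

open MaxLinAA.KernelMachine

/-- The pieces of the string that describes an equation. -/
def rawEquation (S : MaxLinSystem) (j : Fin S.m) : RawEquation where
  coeffs := (List.ofFn fun i => decide (S.A j i = 1)) ++ [decide (S.b j = 1)]
  weight := Computability.encodeNat (S.w j)

theorem encode_rawEquation (S : MaxLinSystem) (j : Fin S.m) :
    (S.rawEquation j).encode = S.encodeEquation j := by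
  simp [rawEquation, encodeEquation, RawEquation.encode, List.map_ofFn, Function.comp_def]

end MaxLinSystem

namespace MaxLinAA

open KernelMachine

variable {p : ℕ → ℝ} {I : Instance p}

/-- The pieces of the string that describes an instance. -/
def Instance.raw (I : Instance p) : RawInstance where
  param := Computability.encodeNat I.k
  vars := List.replicate I.system.n true
  equations := (List.finRange I.system.m).map I.system.rawEquation

theorem Instance.encode_raw (I : Instance p) : I.raw.encode = I.encode := by
  simp [Instance.encode, MaxLinSystem.encode, RawInstance.encode, Instance.raw, List.flatMap_map,
    MaxLinSystem.encode_rawEquation]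

/-- The condition under which the kernelization recognizes a yes-instance. It compares sizes of
binary representations only, so that it can be tested by counting symbols of the encoding. -/
def Instance.IsEvident (I : Instance p) : Prop :=
  (∃ j, I.k.size < (I.system.w j).size) ∨ 2 * I.system.m + 2 < 2 ^ (I.system.n / 2 ^ I.k.size)

theorem Instance.raw_isEvident_iff : I.raw.IsEvident ↔ I.IsEvident := by
  simp [Instance.IsEvident, RawInstance.IsEvident, Instance.raw, MaxLinSystem.rawEquation,
    length_encodeNat]

theorem Instance.isYes_of_size_lt {j : Fin I.system.m} (h : I.k.size < (I.system.w j).size) :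
    I.IsYes := by
  refine le_trans ?_ (I.irreducible.w_le_maxExcess j)
  exact_mod_cast (Nat.lt_size_self I.k).le.trans (Nat.lt_size.1 h)

theorem Instance.isYes_of_lt_two_pow
    (h : 2 * I.system.m + 2 < 2 ^ (I.system.n / 2 ^ I.k.size)) : I.IsYes := by
  refine I.irreducible.le_maxExcess_of_pow_lt ?_
  calc (I.system.m + 1) ^ I.k
      ≤ (I.system.m + 1) ^ 2 ^ I.k.size :=
        Nat.pow_le_pow_right (Nat.succ_pos _) (Nat.lt_size_self I.k).le
    _ < (2 ^ (I.system.n / 2 ^ I.k.size)) ^ 2 ^ I.k.size :=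
        Nat.pow_lt_pow_left (by lia) (Nat.two_pow_pos _).ne'
    _ = 2 ^ (I.system.n / 2 ^ I.k.size * 2 ^ I.k.size) := (pow_mul _ _ _).symm
    _ ≤ 2 ^ I.system.n := Nat.pow_le_pow_right two_pos (Nat.div_mul_le_self _ _)

theorem Instance.IsEvident.isYes (h : I.IsEvident) : I.IsYes :=
  h.elim (fun ⟨_, hj⟩ => isYes_of_size_lt hj) isYes_of_lt_two_pow

theorem two_pow_size_le (k : ℕ) : 2 ^ k.size ≤ 2 * (k + 1) := by
  rcases h : k.size with _ | s
  · rw [pow_zero]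
    lia
  · have hs : 2 ^ s ≤ k := Nat.lt_size.1 (by lia)
    rw [pow_succ]
    lia

theorem cast_le_of_two_pow_le {m d : ℕ} {x : ℝ} (hm : (m : ℝ) < 2 ^ x)
    (hd : 2 ^ d ≤ 2 * m + 2) : (d : ℝ) ≤ |x| + 2 := by
  have hx : (2 : ℝ) ^ x ≤ 2 ^ |x| := Real.rpow_le_rpow_of_exponent_le one_le_two (le_abs_self x)
  have hone : (1 : ℝ) ≤ 2 ^ |x| := Real.one_le_rpow one_le_two (abs_nonneg x)
  refine (Real.rpow_le_rpow_left_iff one_lt_two).1 ?_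
  calc (2 : ℝ) ^ (d : ℝ) ≤ 2 * m + 2 := by rw [Real.rpow_natCast]; exact_mod_cast hd
    _ ≤ 2 ^ |x| * 2 ^ (2 : ℝ) := by norm_num; linarith
    _ = 2 ^ (|x| + 2) := (Real.rpow_add two_pos _ _).symm

theorem Instance.n_le_of_not_isEvident (h : ¬ I.IsEvident) :
    (I.system.n : ℝ) ≤ (|p I.system.n| + 3) * (2 * (I.k + 1)) := by
  have hdiv : ((I.system.n / 2 ^ I.k.size : ℕ) : ℝ) ≤ |p I.system.n| + 2 :=
    cast_le_of_two_pow_le I.m_lt (not_lt.1 fun hlt => h (.inr hlt))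
  have hn : I.system.n ≤ (I.system.n / 2 ^ I.k.size + 1) * (2 * (I.k + 1)) :=
    (Nat.lt_div_mul_add (Nat.two_pow_pos _)).le.trans
      (by rw [← Nat.succ_mul]; exact Nat.mul_le_mul_left _ (two_pow_size_le I.k))
  calc (I.system.n : ℝ) ≤ ((I.system.n / 2 ^ I.k.size : ℕ) + 1) * (2 * (I.k + 1)) := by
        exact_mod_cast hn
    _ ≤ (|p I.system.n| + 3) * (2 * (I.k + 1)) :=
        mul_le_mul_of_nonneg_right (by linarith) (by positivity)

/-- The empty system with parameter `0`, a yes-instance. -/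
def emptyInstance (p : ℕ → ℝ) : Instance p where
  system :=
    { n := 0
      m := 0
      A := 0
      b := 0
      w := 0
      w_pos := fun j => j.elim0
      row_ne_zero := fun j => j.elim0 }
  k := 0
  irreducible := ⟨Matrix.rank_zero, fun j => j.elim0⟩
  m_lt := by
    rw [Nat.cast_zero]
    exact Real.rpow_pos_of_pos two_pos _

theorem emptyInstance_isYes : (emptyInstance p).IsYes :=
  MaxLinSystem.maxExcess_nonneg _

theorem emptyInstance_encode : (emptyInstance p).encode = [none, none] := rfl

open Classical in
/-- The kernelization: the evident yes-instances are replaced by the empty one. -/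
noncomputable def kernel (I : Instance p) : Instance p :=
  if I.IsEvident then emptyInstance p else I

theorem kernel_of_isEvident (h : I.IsEvident) : kernel I = emptyInstance p := if_pos h

theorem kernel_of_not_isEvident (h : ¬ I.IsEvident) : kernel I = I := if_neg h

theorem isYes_kernel_iff (I : Instance p) : (kernel I).IsYes ↔ I.IsYes := by
  by_cases h : I.IsEvident
  · rw [kernel_of_isEvident h]
    exact iff_of_true emptyInstance_isYes h.isYes
  · rw [kernel_of_not_isEvident h]

theorem k_kernel_le (I : Instance p) : (kernel I).k ≤ I.k := by
  by_cases h : I.IsEvident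
  · rw [kernel_of_isEvident h]
    exact Nat.zero_le _
  · rw [kernel_of_not_isEvident h]

theorem n_kernel_le (I : Instance p) :
    ((kernel I).system.n : ℝ) ≤ (|p (kernel I).system.n| + 3) * (2 * (I.k + 1)) := by
  by_cases h : I.IsEvident
  · have hn : (kernel I).system.n = 0 := by rw [kernel_of_isEvident h]; rfl
    rw [hn, Nat.cast_zero]
    positivity
  · rw [kernel_of_not_isEvident h]
    exact Instance.n_le_of_not_isEvident h

theorem size_w_kernel_le (I : Instance p) (j : Fin (kernel I).system.m) :
    ((kernel I).system.w j).size ≤ I.k.size := by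
  by_cases h : I.IsEvident
  · have hm : (kernel I).system.m = 0 := by rw [kernel_of_isEvident h]; rfl
    exact (hm ▸ j).elim0
  · revert j
    rw [kernel_of_not_isEvident h]
    exact fun j => not_lt.1 fun hlt => h (.inl ⟨j, hlt⟩)

theorem nonempty_tm2ComputableInPolyTime_kernel :
    Nonempty (Turing.TM2ComputableInPolyTime
      (Instance.encode (p := p)) (Instance.encode (p := p)) kernel) := by
  classical
  refine nonempty_tm2ComputableInPolyTime (4 * (Polynomial.X + 3) ^ 2) fun I => ?_
  have hencode : (kernel I).encode = if I.raw.IsEvident then [none, none] else I.raw.encode := by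
    rw [I.encode_raw, I.raw_isEvident_iff, ← emptyInstance_encode (p := p), ← apply_ite, kernel]
  rw [hencode, ← I.encode_raw]
  simpa using run_program I.raw

theorem isKernelization_kernel {h : ℕ → ℕ} (hn : ∀ I : Instance p, (kernel I).system.n ≤ h I.k) :
    IsKernelization (kernel (p := p)) := by
  refine ⟨nonempty_tm2ComputableInPolyTime_kernel, fun I => (isYes_kernel_iff I).symm,
    ⟨id, k_kernel_le⟩, fun k => h k + 1 + 2 ^ h k * (h k + 3 + k.size), fun I => ?_⟩
  have hm : (kernel I).system.m ≤ 2 ^ h I.k :=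
    (kernel I).irreducible.m_le_two_pow.trans (Nat.pow_le_pow_right two_pos (hn I))
  refine ((kernel I).system.length_encode_le (size_w_kernel_le I)).trans ?_
  have hnI := hn I
  beta_reduce
  gcongr

end MaxLinAA

theorem le_rpow_one_div_of_le_mul_rpow {a x y : ℝ} (ha : a < 1) (hx : 0 < x) (hy : 0 ≤ y)
    (h : x ≤ y * x ^ a) : x ≤ y ^ (1 / (1 - a)) := by
  have hsplit : x ^ (1 - a) * x ^ a = x := by
    rw [← Real.rpow_add hx, sub_add_cancel, Real.rpow_one]
  have hle : x ^ (1 - a) ≤ y :=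
    le_of_mul_le_mul_right (hsplit.le.trans h) (Real.rpow_pos_of_pos hx a)
  rw [one_div]
  exact (Real.le_rpow_inv_iff_of_pos hx.le hy (sub_pos.2 ha)).2 hle

theorem exists_isBigO_forall_le {a c : ℝ} (ha₀ : 0 ≤ a) (ha₁ : a < 1) (hc : 0 ≤ c) {p : ℕ → ℝ}
    (hp : p =O[atTop] fun n : ℕ => (n : ℝ) ^ a) {K : ℕ → ℝ} (hK₀ : ∀ k, 0 ≤ K k)
    (hK : K =O[atTop] fun k : ℕ => (k : ℝ)) :
    ∃ h : ℕ → ℝ, (h =O[atTop] fun k : ℕ => (k : ℝ) ^ (1 / (1 - a))) ∧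
      ∀ n k : ℕ, (n : ℝ) ≤ (|p n| + c) * K k → (n : ℝ) ≤ h k := by
  obtain ⟨C, hC, hbound⟩ := bound_of_isBigO_nat_atTop hp
  refine ⟨fun k => ((C + c) * K k) ^ (1 / (1 - a)), ?_, fun n k hnk => ?_⟩
  · exact (hK.const_mul_left (C + c)).rpow (one_div_nonneg.2 (sub_nonneg.2 ha₁.le))
      (.of_forall fun k => Nat.cast_nonneg k)
  · have hy : 0 ≤ (C + c) * K k := mul_nonneg (add_nonneg hC.le hc) (hK₀ k)
    rcases n.eq_zero_or_pos with rfl | hn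
    · rw [Nat.cast_zero]
      exact Real.rpow_nonneg hy _
    · have hn₁ : (1 : ℝ) ≤ n := by exact_mod_cast hn
      have hpos : (0 : ℝ) < (n : ℝ) ^ a := Real.rpow_pos_of_pos (by linarith) a
      have hpn : |p n| ≤ C * (n : ℝ) ^ a := by
        simpa only [Real.norm_eq_abs, abs_of_pos hpos] using hbound hpos.ne'
      have hcn : c ≤ c * (n : ℝ) ^ a := le_mul_of_one_le_right hc (Real.one_le_rpow hn₁ ha₀)
      refine le_rpow_one_div_of_le_mul_rpow ha₁ (by linarith) hy (hnk.trans ?_)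
      calc (|p n| + c) * K k ≤ (C * (n : ℝ) ^ a + c * (n : ℝ) ^ a) * K k :=
            mul_le_mul_of_nonneg_right (add_le_add hpn hcn) (hK₀ k)
        _ = (C + c) * K k * (n : ℝ) ^ a := by ring

theorem isBigO_two_mul_add_one :
    (fun k : ℕ => 2 * ((k : ℝ) + 1)) =O[atTop] fun k : ℕ => (k : ℝ) := by
  refine IsBigO.of_bound 4 (eventually_atTop.2 ⟨1, fun k hk => ?_⟩)
  have hk₁ : (1 : ℝ) ≤ k := by exact_mod_cast hk
  rw [Real.norm_of_nonneg (by positivity), Real.norm_of_nonneg (by positivity)]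
  linarith

theorem mainTheorem10 (a : ℝ) (ha₀ : 0 < a) (ha₁ : a < 1)
    (p : ℕ → ℝ) (hp : p =O[atTop] fun n : ℕ => (n : ℝ) ^ a) :
    ∃ κ : MaxLinAA.Instance p → MaxLinAA.Instance p,
      MaxLinAA.IsKernelization κ ∧
      ∃ h : ℕ → ℝ, (h =O[atTop] fun k : ℕ => (k : ℝ) ^ (1 / (1 - a))) ∧
        ∀ I : MaxLinAA.Instance p, ((κ I).system.n : ℝ) ≤ h I.k := by
  obtain ⟨h, hO, hle⟩ := exists_isBigO_forall_le (c := 3) ha₀.le ha₁ zero_le_three hp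
    (fun k => by positivity) isBigO_two_mul_add_one
  have hn (I : MaxLinAA.Instance p) : ((MaxLinAA.kernel I).system.n : ℝ) ≤ h I.k :=
    hle _ _ (MaxLinAA.n_kernel_le I)
  have hkernel : MaxLinAA.IsKernelization (MaxLinAA.kernel (p := p)) :=
    MaxLinAA.isKernelization_kernel (h := fun k => ⌊h k⌋₊) fun I => Nat.le_floor (hn I)
  exact ⟨MaxLinAA.kernel, hkernel, h, hO, hn⟩
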